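/- Let $\mathring\Phi$ be a reduced irreducible (crystallographic) finite root system in a Euclidean space $V$, let $m\in\{1,2,3\}$ be its lacing number (the maximal ratio of squared lengths of two roots), let $\mathring\Phi_\ell$ be the set of roots of maximal length (long roots) and $\mathring\Phi_s=\mathring\Phi\setminus\mathring\Phi_\ell$ the set of short roots. Equip $V\oplus\mathbb R$ with the form $(v_1\oplus y_1,v_2\oplus y_2)=(v_1,v_2)$, and let $$\Phi=\{\alpha\oplus n:\alpha\in\mathring\Phi,\ n\in\mathbb Z\}\subseteq V\oplus\mathbb R$$ be the set of real roots of the corresponding untwisted affine root system. In $\Phi$, as in $\mathring\Phi$, a *root subsystem* is a non-empty subset $\Psi$ such that $s_\alpha(\beta)=\beta-2\frac{(\beta,\alpha)}{(\alpha,\alpha)}\alpha\in\Psi$ for all $\alpha,\beta\in\Psi$; it is *maximal* if it is proper and not strictly contained in another proper root subsystem. For $\Psi\subseteq\Phi$ put $\mathrm{Gr}(\Psi)=\{\alpha\in\mathring\Phi:\alpha\oplus y\in\Psi\text{ for some }y\}$. A subset $\Psi\subseteq\Phi$ is a maximal root subsystem of $\Phi$ if and only if one of the following holds: 1. $\mathrm{Gr}(\Psi)$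 is a maximal root subsystem of $\mathring\Phi$, $\mathrm{Gr}(\Psi)\neq\mathring\Phi_s$, and $\Psi=\{\alpha\oplus n:\alpha\in\mathrm{Gr}(\Psi),\ n\in\mathbb Z\}$. 2. There is a $\mathbb Z$-linear map $p$ from the root lattice $\mathbb Z\mathring\Phi$ to $\mathbb Z$, $\alpha\mapsto p_\alpha$, with $\alpha\oplus p_\alpha\in\Psi$ for all $\alpha\in\mathring\Phi$, such that one of the following holds: (a) $m\neq1$ (that is, $\mathring\Phi$ is not simply laced) and $$\Psi=\{\alpha\oplus n:\alpha\in\mathring\Phi_s,\ n\in\mathbb Z\}\cup\{\alpha\oplus(p_\alpha+mn):\alpha\in\mathring\Phi_\ell,\ n\in\mathbb Z\};$$ (b) there is a prime number $q\neq m$ such that $$\Psi=\{\alpha\oplus(p_\alpha+qn):\alpha\in\mathring\Phi,\ n\in\mathbb Z\}.$$ -/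

import Mathlib

/-- The reflection `s_a(x) = x - 2 (x,a)/(a,a) a` attached to a bilinear form `B` and a
vector `a` with `(a,a) ≠ 0`. -/
noncomputable def formReflection {X : Type*} [AddCommGroup X] [Module ℝ X]
    (B : LinearMap.BilinForm ℝ X) (a x : X) : X :=
  x - (2 * B x a / B a a) • a

/-- `Ψ` is a root subsystem of the set of (real) roots `Φ`: a non-empty subset of `Φ` that is
stable under the reflections in its own elements. -/
def IsRootSubsystem {X : Type*} [AddCommGroup X] [Module ℝ X]
    (B : LinearMap.BilinForm ℝ X) (Φ Ψ : Set X) : Prop :=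
  Ψ ⊆ Φ ∧ Ψ.Nonempty ∧ ∀ a ∈ Ψ, ∀ b ∈ Ψ, formReflection B a b ∈ Ψ

/-- `Ψ` is a maximal root subsystem of `Φ`: a proper root subsystem that is not strictly
contained in another proper root subsystem. -/
def IsMaximalRootSubsystem {X : Type*} [AddCommGroup X] [Module ℝ X]
    (B : LinearMap.BilinForm ℝ X) (Φ Ψ : Set X) : Prop :=
  IsRootSubsystem B Φ Ψ ∧ Ψ ≠ Φ ∧
    ∀ Ψ' : Set X, IsRootSubsystem B Φ Ψ' → Ψ ⊆ Ψ' → Ψ' ≠ Φ → Ψ = Ψ'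

/-- The form `(v₁ ⊕ y₁, v₂ ⊕ y₂) = (v₁, v₂)` on `X = V ⊕ ℝ`. -/
noncomputable def affineForm (V : Type*) [NormedAddCommGroup V] [InnerProductSpace ℝ V] :
    LinearMap.BilinForm ℝ (V × ℝ) :=
  (innerₗ V).compl₁₂ (LinearMap.fst ℝ V ℝ) (LinearMap.fst ℝ V ℝ)

/-- The set `{α ⊕ n : α ∈ S, n ∈ ℤ}` in `V ⊕ ℝ`. For `S` the set of all roots of a finite root
system this is the set of real roots of the untwisted affine root system; for `S` a root
subsystem of the finite root system it is the lift of `S`. -/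
def untwistedLift {V : Type*} (S : Set V) : Set (V × ℝ) :=
  {x | x.1 ∈ S ∧ ∃ n : ℤ, x.2 = n}

/-- The gradient `Gr(Ψ)` of a set `Ψ` of affine roots. -/
def rootGradient {V : Type*} (Ψ : Set (V × ℝ)) : Set V :=
  {α | ∃ y : ℝ, (α, y) ∈ Ψ}

/-- The long elements of a set of roots `R`: those of maximal length (if there is only one root
length, then every root is long). -/
def longRoots {V : Type*} [NormedAddCommGroup V] (R : Set V) : Set V :=
  {α ∈ R | ∀ β ∈ R, ‖β‖ ≤ ‖α‖}

/-- The short elements of a set of roots `R`: those that are not long. -/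
def shortRoots {V : Type*} [NormedAddCommGroup V] (R : Set V) : Set V :=
  R \ longRoots R

/-- The lacing number of an irreducible root system: the greatest integer that occurs as the
ratio of the squared lengths of two roots (so `1` for the types `A`, `D`, `E`, `2` for the types
`B`, `C`, `F` and `3` for the type `G`). -/
noncomputable def lacingNumber {V : Type*} [NormedAddCommGroup V] (R : Set V) : ℕ :=
  sSup {k : ℕ | ∃ α ∈ R, ∃ β ∈ R, ‖α‖ ^ 2 = k * ‖β‖ ^ 2}

/-! A subsystem `Ψ` assigns to each root `α` the set `Z α` of integers `n` with `α ⊕ n ∈ Ψ`.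
Stability under affine reflections says that `b - ⟨β, α⟩ a` lies in the set of `s_α β` for `a ∈ Z
α`, `b ∈ Z β`.

If the gradient is proper, maximality forces `Ψ` to be the lift of its gradient. The short roots are
excluded because their lift lies in a proper subsystem of type 2(a).

If the gradient is full, choosing values on a base gives a linear `p` with `p α ∈ Z α` for all `α`.
Translating by `p` turns each `Z α` into `n_α ℤ`, with `n` Weyl invariant and `n_β ∣ ⟨β, α⟩ n_α`
(`IsReflectionStable.exists_coset`). By irreducibility `n` takes one value `l` on long and one value
`s` on short roots, with `s ∣ l ∣ m s` (`exists_moduli`). Conversely every such pair gives a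
subsystem (`isRootSubsystem_cosetRoots`), so maximality becomes a divisibility question. As `m` is
`1` or prime, the minimal nontrivial pairs are `(m, 1)` for `m ≠ 1` and `(q, q)` for primes `q ≠ m`;
the pair `(m, m)` is beaten by `(m, 1)`. -/

open Module Submodule

/-! ### Sets of integers stable under reflections -/

section Lattice

/-- A set of integers that contains `0` and is stable under `(a, b) ↦ a - 2 b` and negation is the
set of multiples of some natural number. -/
lemma exists_forall_mem_iff_dvd (Z : Set ℤ) (h0 : 0 ∈ Z) (hneg : ∀ a ∈ Z, -a ∈ Z)
    (h2 : ∀ a ∈ Z, ∀ b ∈ Z, a - 2 * b ∈ Z) : ∃ n : ℕ, ∀ x, x ∈ Z ↔ (n : ℤ) ∣ x := by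
  have hmul (x y : ℤ) (hx : x ∈ Z) (hy : y ∈ Z) (k : ℤ) : x + 2 * k * y ∈ Z := by
    induction k using Int.induction_on with
    | zero => simpa using hx
    | succ i ih => convert h2 _ ih _ (hneg _ hy) using 1; ring
    | pred i ih => convert h2 _ ih _ hy using 1; ring
  have hall (y : ℤ) (hy : y ∈ Z) (k : ℤ) : k * y ∈ Z := by
    rcases Int.even_or_odd' k with ⟨l, rfl | rfl⟩
    · simpa using hmul 0 y h0 hy l
    · convert hmul y y hy hy l using 1; ring
  by_cases hZ : ∃ n : ℕ, 0 < n ∧ (n : ℤ) ∈ Z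
  · classical
    obtain ⟨hpos, hmem⟩ := Nat.find_spec hZ
    have hmin : ∀ k : ℕ, 0 < k → (k : ℤ) ∈ Z → Nat.find hZ ≤ k :=
      fun k h h' ↦ Nat.find_min' hZ ⟨h, h'⟩
    generalize Nat.find hZ = n at hpos hmem hmin
    refine ⟨n, fun x ↦ ⟨fun hx ↦ ?_, ?_⟩⟩
    -- Only even multiples of `n` can be subtracted from `x`, so the reduction is modulo `2 * n`. A
    -- nonzero residue `r` has both `r` and `2 * n - r` in `Z`; both are at least the minimum `n`,
    -- so `r = n`.
    · have hr : x % (2 * n) ∈ Z := by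
        convert hmul x n hx hmem (-(x / (2 * n))) using 1
        rw [Int.emod_def]; ring
      have hr0 := Int.emod_nonneg x (b := 2 * n) (by lia)
      have hr1 := Int.emod_lt_of_pos x (b := 2 * n) (by lia)
      have key : (n : ℤ) ∣ x % (2 * n) := by
        generalize x % (2 * n) = r at hr hr0 hr1
        lift r to ℕ using hr0
        rcases Nat.eq_zero_or_pos r with rfl | hrpos
        · simp
        have hge := hmin r hrpos hr
        have hle := hmin (2 * n - r) (by lia) (by
          convert hmul _ n (hneg _ hr) hmem 1 using 1
          rw [Nat.cast_sub (by lia)]; push_cast; ring)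
        have : r = n := by lia
        simp [this]
      rw [← Int.emod_add_mul_ediv x (2 * n)]
      exact dvd_add key ⟨2 * (x / (2 * n)), by ring⟩
    · rintro ⟨k, rfl⟩
      rw [mul_comm]; exact hall _ hmem k
  · refine ⟨0, fun x ↦ ⟨fun hx ↦ ?_, ?_⟩⟩
    · push Not at hZ
      simp only [Nat.cast_zero, zero_dvd_iff]
      by_contra hne
      rcases lt_or_gt_of_ne hne with h | h
      · exact hZ x.natAbs (by lia) (by rw [Int.ofNat_natAbs_of_nonpos h.le]; exact hneg _ hx)
      · exact hZ x.natAbs (by lia) (by rwa [Int.natAbs_of_nonneg h.le])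
    · simp only [Nat.cast_zero, zero_dvd_iff]; rintro rfl; exact h0

end Lattice

/-! ### Reflection stable families indexed by the roots -/

namespace RootPairing

variable {ι V N : Type*} [AddCommGroup V] [Module ℝ V] [AddCommGroup N] [Module ℝ N]
  (P : RootPairing ι ℝ V N) [P.IsCrystallographic]

/-- A family of sets of integers, indexed by the roots, such that the affine roots `α ⊕ n` with `n`
in the set of `α` are stable under the reflections in each other. -/
def IsReflectionStable (Z : ι → Set ℤ) : Prop :=
  ∀ i j, ∀ a ∈ Z i, ∀ b ∈ Z j, b - P.pairingIn ℤ j i * a ∈ Z (P.reflectionPerm i j)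

lemma rootSpanMem_reflectionPerm (i j : ι) :
    P.rootSpanMem ℤ (P.reflectionPerm i j) =
      P.rootSpanMem ℤ j - P.pairingIn ℤ j i • P.rootSpanMem ℤ i := by
  ext
  simp only [Submodule.coe_sub, Submodule.coe_smul, root_reflectionPerm]
  exact P.reflection_apply_root' ℤ

lemma map_rootSpanMem_reflectionPerm (p : P.rootSpan ℤ →ₗ[ℤ] ℤ) (i j : ι) :
    p (P.rootSpanMem ℤ (P.reflectionPerm i j)) =
      p (P.rootSpanMem ℤ j) - P.pairingIn ℤ j i * p (P.rootSpanMem ℤ i) := by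
  rw [rootSpanMem_reflectionPerm, map_sub, map_smul, smul_eq_mul]

/-- If every set of a reflection stable family is non-empty, the sets have representatives that
depend linearly on the root. -/
lemma IsReflectionStable.exists_linearMap_mem [Finite ι] [P.IsReduced] [P.IsRootSystem] {Z : ι → Set ℤ}
    (hZ : P.IsReflectionStable Z) (hne : ∀ i, (Z i).Nonempty) :
    ∃ p : P.rootSpan ℤ →ₗ[ℤ] ℤ, ∀ i, p (P.rootSpanMem ℤ i) ∈ Z i := by
  obtain ⟨b⟩ := P.nonempty_base
  choose z hz using hne
  -- The values on a base may be chosen freely. Membership spreads to all roots because simple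
  -- reflections generate them from the base and `p` transforms by the same rule as the family.
  let p : P.rootSpan ℤ →ₗ[ℤ] ℤ := b.toWeightBasisInt.constr ℤ fun i ↦ z i
  have hp (i : ι) (hi : i ∈ b.support) : p (P.rootSpanMem ℤ i) = z i := by
    have : P.rootSpanMem ℤ i = b.toWeightBasisInt ⟨i, hi⟩ := by ext; simp
    rw [this, Basis.constr_basis]
  have hrefl (i j : ι) (hi : p (P.rootSpanMem ℤ i) ∈ Z i) (hj : p (P.rootSpanMem ℤ j) ∈ Z j) :
      p (P.rootSpanMem ℤ (P.reflectionPerm i j)) ∈ Z (P.reflectionPerm i j) := by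
    rw [map_rootSpanMem_reflectionPerm]
    exact hZ i j _ hi _ hj
  have hbase (i : ι) (hi : i ∈ b.support) : p (P.rootSpanMem ℤ i) ∈ Z i := by
    rw [hp i hi]; exact hz i
  refine ⟨p, fun i ↦ b.induction_reflect i (p := fun i ↦ p (P.rootSpanMem ℤ i) ∈ Z i)
    (fun i hi ↦ hrefl i i hi hi) hbase fun i j hi hj ↦ hrefl j i (hbase j hj) hi⟩

/-- A reflection stable family of non-empty sets consists of cosets, whose moduli are invariant
under the Weyl group and satisfy divisibility relations. -/
lemma IsReflectionStable.exists_coset [Finite ι] [P.IsReduced] [P.IsRootSystem] {Z : ι → Set ℤ}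
    (hZ : P.IsReflectionStable Z) (hne : ∀ i, (Z i).Nonempty) :
    ∃ (p : P.rootSpan ℤ →ₗ[ℤ] ℤ) (n : ι → ℕ),
      (∀ i x, x ∈ Z i ↔ (n i : ℤ) ∣ x - p (P.rootSpanMem ℤ i)) ∧
      (∀ i j, n (P.reflectionPerm i j) = n j) ∧
      ∀ i j, (n j : ℤ) ∣ P.pairingIn ℤ j i * n i := by
  obtain ⟨p, hp⟩ := hZ.exists_linearMap_mem P hne
  let Y : ι → Set ℤ := fun i ↦ {x | x + p (P.rootSpanMem ℤ i) ∈ Z i}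
  have hY : P.IsReflectionStable Y := fun i j a ha b hb ↦ by
    have := hZ i j _ ha _ hb
    simp only [Y, Set.mem_ofPred_eq, map_rootSpanMem_reflectionPerm]
    convert this using 1; ring
  have hY0 (i : ι) : 0 ∈ Y i := by simpa [Y] using hp i
  -- Reflecting in the element `0 ∈ Y i` moves the root without changing the integer.
  have hYr (i j : ι) : Y (P.reflectionPerm i j) = Y j := by
    have aux (j : ι) : Y j ⊆ Y (P.reflectionPerm i j) := fun x hx ↦ by
      simpa using hY i j 0 (hY0 i) x hx
    refine (aux j).antisymm' ?_
    simpa using aux (P.reflectionPerm i j)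
  have hY' (i j : ι) (a b : ℤ) (ha : a ∈ Y i) (hb : b ∈ Y j) :
      b - P.pairingIn ℤ j i * a ∈ Y j := by
    rw [← hYr i j]; exact hY i j a ha b hb
  have key (i : ι) : ∃ n : ℕ, ∀ x, x ∈ Y i ↔ (n : ℤ) ∣ x := by
    have h2 : ∀ a ∈ Y i, ∀ b ∈ Y i, a - 2 * b ∈ Y i := fun a ha b hb ↦ by
      simpa using hY' i i b a hb ha
    refine exists_forall_mem_iff_dvd _ (hY0 i) (fun a ha ↦ ?_) h2
    convert h2 a ha a ha using 1; ring
  choose n hn using key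
  refine ⟨p, n, fun i x ↦ ?_, fun i j ↦ ?_, fun i j ↦ ?_⟩
  · rw [← hn]; simp [Y]
  · have : ∀ x : ℤ, (n (P.reflectionPerm i j) : ℤ) ∣ x ↔ (n j : ℤ) ∣ x := fun x ↦ by
      rw [← hn, ← hn, hYr]
    exact Nat.dvd_antisymm (Int.natCast_dvd_natCast.1 ((this _).2 dvd_rfl))
      (Int.natCast_dvd_natCast.1 ((this _).1 dvd_rfl))
  · have := hY' i j (n i) 0 ((hn _ _).2 dvd_rfl) (hY0 j)
    rw [hn, zero_sub, dvd_neg] at this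
    exact this

omit [P.IsCrystallographic] in
/-- In an irreducible root system, no root is orthogonal to a non-empty set of roots that is
invariant under the Weyl group. -/
lemma exists_mem_pairing_ne_zero [P.IsIrreducible] {T : Set ι} (hT : T.Nonempty)
    (hTr : ∀ i, ∀ j ∈ T, P.reflectionPerm i j ∈ T) (i : ι) : ∃ k ∈ T, P.pairing k i ≠ 0 := by
  by_contra! h
  -- The span of `T` is a nonzero invariant subspace, hence everything; but the coroot of `i`, which
  -- would vanish on it, takes the value `2` on the root `i`.
  have htop : span ℝ (P.root '' T) = ⊤ := by
    refine IsIrreducible.eq_top_of_invtSubmodule_reflection (P := P) _ (fun j ↦ ?_) ?_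
    · rw [Module.End.mem_invtSubmodule, span_le]
      rintro - ⟨k, hk, rfl⟩
      exact subset_span ⟨P.reflectionPerm j k, hTr j k hk, by simp⟩
    · obtain ⟨k, hk⟩ := hT
      exact fun h0 ↦ P.ne_zero k ((Submodule.eq_bot_iff _).1 h0 _ (subset_span ⟨k, hk, rfl⟩))
  have hle : span ℝ (P.root '' T) ≤ LinearMap.ker (P.coroot' i) := by
    rw [span_le]
    rintro - ⟨k, hk, rfl⟩
    simpa using h k hk
  rw [htop] at hle
  have := hle (mem_top (x := P.root i))
  simp at this

end RootPairing

/-! ### Root lengths and the lacing number -/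

namespace RootPairing

section Length

variable {ι V N : Type*} [NormedAddCommGroup V] [InnerProductSpace ℝ V] [AddCommGroup N]
  [Module ℝ N] (P : RootPairing ι ℝ V N)

/-- The inner product as an invariant form of a root pairing whose reflections are orthogonal. -/
noncomputable def innerInvariantForm
    (hP : ∀ (i : ι) (v : V), P.reflection i v = formReflection (innerₗ V) (P.root i) v) :
    P.InvariantForm where
  form := innerₗ V
  symm := ⟨fun x y ↦ by simp [real_inner_comm]⟩
  ne_zero i := by simpa using P.ne_zero i
  isOrthogonal_reflection i x y := by
    have h0 : inner ℝ (P.root i) (P.root i) ≠ 0 := by simpa using P.ne_zero i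
    simp only [hP, formReflection, innerₗ_apply_apply, inner_sub_left,
      inner_sub_right, real_inner_smul_left, real_inner_smul_right,
      real_inner_comm y (P.root i)]
    field_simp
    ring

variable {P}
variable (hP : ∀ (i : ι) (v : V), P.reflection i v = formReflection (innerₗ V) (P.root i) v)

lemma innerInvariantForm_root_root (i : ι) :
    (P.innerInvariantForm hP).form (P.root i) (P.root i) = ‖P.root i‖ ^ 2 := by
  simp [innerInvariantForm]

include hP

lemma norm_root_reflectionPerm (i j : ι) :
    ‖P.root (P.reflectionPerm i j)‖ = ‖P.root j‖ := by
  have := (P.innerInvariantForm hP).apply_reflection_reflection i (P.root j) (P.root j)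
  rw [← root_reflectionPerm, innerInvariantForm_root_root, innerInvariantForm_root_root] at this
  exact (sq_eq_sq₀ (norm_nonneg _) (norm_nonneg _)).1 this

lemma pairingIn_mul_sq_norm [P.IsCrystallographic] (i j : ι) :
    P.pairingIn ℤ j i * ‖P.root i‖ ^ 2 = P.pairingIn ℤ i j * ‖P.root j‖ ^ 2 := by
  have := (P.innerInvariantForm hP).pairing_mul_eq_pairing_mul_swap i j
  rw [innerInvariantForm_root_root, innerInvariantForm_root_root, ← P.algebraMap_pairingIn ℤ,
    ← P.algebraMap_pairingIn ℤ] at this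
  simpa using this

omit hP in
lemma root_mem_longRoots_iff (i : ι) :
    P.root i ∈ longRoots (Set.range P.root) ↔ ∀ j, ‖P.root j‖ ≤ ‖P.root i‖ := by
  simp [longRoots]

omit hP in
lemma root_mem_shortRoots_iff (i : ι) :
    P.root i ∈ shortRoots (Set.range P.root) ↔ P.root i ∉ longRoots (Set.range P.root) := by
  simp [shortRoots]

lemma reflectionPerm_mem_longRoots_iff (i j : ι) :
    P.root (P.reflectionPerm i j) ∈ longRoots (Set.range P.root) ↔
      P.root j ∈ longRoots (Set.range P.root) := by
  simp only [root_mem_longRoots_iff, norm_root_reflectionPerm hP]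

omit hP in
lemma norm_eq_of_mem_longRoots {i j : ι} (hi : P.root i ∈ longRoots (Set.range P.root))
    (hj : P.root j ∈ longRoots (Set.range P.root)) : ‖P.root i‖ = ‖P.root j‖ := by
  rw [root_mem_longRoots_iff] at hi hj
  exact le_antisymm (hj i) (hi j)

omit hP in
lemma exists_mem_longRoots [Finite ι] [Nonempty ι] :
    ∃ i, P.root i ∈ longRoots (Set.range P.root) := by
  obtain ⟨i, hi⟩ := Finite.exists_max fun i ↦ ‖P.root i‖
  exact ⟨i, (root_mem_longRoots_iff i).2 hi⟩

/-- Either all roots are long and the lacing number is `1`, or there are roots of two lengths and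
the lacing number is a prime number, the ratio of their squares. -/
lemma lacingNumber_cases [Finite ι] [Nonempty ι] [P.IsCrystallographic] [P.IsReduced]
    [P.IsIrreducible] :
    (lacingNumber (Set.range P.root) = 1 ∧ ∀ i, P.root i ∈ longRoots (Set.range P.root)) ∨
    ((lacingNumber (Set.range P.root)).Prime ∧
      (∃ j, P.root j ∉ longRoots (Set.range P.root)) ∧
      ∀ i j, P.root i ∈ longRoots (Set.range P.root) → P.root j ∉ longRoots (Set.range P.root) →
        ‖P.root i‖ ^ 2 = lacingNumber (Set.range P.root) * ‖P.root j‖ ^ 2) := by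
  have hpos (i : ι) : 0 < ‖P.root i‖ ^ 2 := by
    have := norm_pos_iff.2 (P.ne_zero i); positivity
  by_cases hall : ∀ i, P.root i ∈ longRoots (Set.range P.root)
  · refine .inl ⟨?_, hall⟩
    have : {k : ℕ | ∃ α ∈ Set.range P.root, ∃ β ∈ Set.range P.root, ‖α‖ ^ 2 = k * ‖β‖ ^ 2} =
        {1} := by
      ext k
      simp only [Set.exists_range_iff, Set.mem_ofPred_eq, Set.mem_singleton_iff]
      constructor
      · rintro ⟨i, j, h⟩
        rw [norm_eq_of_mem_longRoots (hall i) (hall j)] at h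
        have := hpos j
        exact_mod_cast (mul_right_cancel₀ this.ne' ((one_mul _).trans h)).symm
      · rintro rfl
        exact ⟨Classical.arbitrary ι, Classical.arbitrary ι, by simp⟩
    rw [lacingNumber, this, csSup_singleton]
  · refine .inr ?_
    push Not at hall
    obtain ⟨j₀, hj₀⟩ := hall
    obtain ⟨i₀, hi₀⟩ := exists_mem_longRoots (P := P)
    have hlt {i j : ι} (hi : P.root i ∈ longRoots (Set.range P.root))
        (hj : P.root j ∉ longRoots (Set.range P.root)) : ‖P.root j‖ ^ 2 < ‖P.root i‖ ^ 2 := by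
      rw [root_mem_longRoots_iff] at hi hj
      push Not at hj
      obtain ⟨k, hk⟩ := hj
      exact pow_lt_pow_left₀ (hk.trans_le (hi k)) (norm_nonneg _) two_ne_zero
    -- Squared lengths have ratio `1`, `2` or `3` in some order, and once two lengths differ every
    -- root has one of these two.
    have hB := (P.innerInvariantForm hP).apply_eq_or i₀ j₀
    have hB' := (P.innerInvariantForm hP).apply_eq_or_of_apply_ne (i := i₀) (j := j₀)
    simp only [innerInvariantForm_root_root] at hB hB'
    have h0 := hlt hi₀ hj₀
    specialize hB' h0.ne'
    have hp0 := hpos i₀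
    have hp1 := hpos j₀
    obtain ⟨m, hm, hmr⟩ : ∃ m : ℕ, m.Prime ∧ ‖P.root i₀‖ ^ 2 = m * ‖P.root j₀‖ ^ 2 := by
      rcases hB with h | h | h | h | h
      · linarith
      · exact ⟨2, Nat.prime_two, by simpa using h⟩
      · exact ⟨3, Nat.prime_three, by simpa using h⟩
      · linarith
      · linarith
    have hlen (i j : ι) (hi : P.root i ∈ longRoots (Set.range P.root))
        (hj : P.root j ∉ longRoots (Set.range P.root)) :
        ‖P.root i‖ ^ 2 = m * ‖P.root j‖ ^ 2 := by
      rw [norm_eq_of_mem_longRoots hi hi₀, hmr]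
      rcases hB' j with h | h
      · exact absurd h (hlt hi₀ hj).ne
      · rw [h]
    have hgr : IsGreatest
        {k : ℕ | ∃ α ∈ Set.range P.root, ∃ β ∈ Set.range P.root, ‖α‖ ^ 2 = k * ‖β‖ ^ 2} m := by
      refine ⟨⟨_, ⟨i₀, rfl⟩, _, ⟨j₀, rfl⟩, hmr⟩, ?_⟩
      rintro k ⟨-, ⟨i, rfl⟩, -, ⟨j, rfl⟩, h⟩
      have hm1 : (1 : ℝ) ≤ m := by exact_mod_cast hm.one_lt.le
      have hj : ‖P.root j₀‖ ^ 2 ≤ ‖P.root j‖ ^ 2 := by rcases hB' j with h | h <;> linarith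
      have hi : ‖P.root i‖ ^ 2 ≤ m * ‖P.root j₀‖ ^ 2 := by rcases hB' i with h | h <;> linarith
      have : (k : ℝ) * ‖P.root j₀‖ ^ 2 ≤ m * ‖P.root j₀‖ ^ 2 := by
        refine le_trans ?_ hi
        rw [h]; gcongr
      exact_mod_cast le_of_mul_le_mul_right this hp1
    have hmeq : lacingNumber (Set.range P.root) = m := hgr.csSup_eq
    rw [hmeq]
    exact ⟨hm, ⟨j₀, hj₀⟩, hlen⟩

/-! ### Moduli as functions of the root length -/

variable [Finite ι] [P.IsCrystallographic] [P.IsReduced] [P.IsIrreducible]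

lemma pairingIn_long_short {i j : ι} (hi : P.root i ∈ longRoots (Set.range P.root))
    (hj : P.root j ∉ longRoots (Set.range P.root)) :
    P.pairingIn ℤ i j = lacingNumber (Set.range P.root) * P.pairingIn ℤ j i := by
  have : Nonempty ι := ⟨i⟩
  rcases lacingNumber_cases hP with ⟨-, h⟩ | ⟨-, -, h⟩
  · exact absurd (h j) hj
  · have h1 := pairingIn_mul_sq_norm hP i j
    have := norm_pos_iff.2 (P.ne_zero j)
    rw [h i j hi hj, ← mul_assoc] at h1
    have := mul_right_cancel₀ (by positivity) h1
    rw [mul_comm]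
    exact_mod_cast this.symm

omit [P.IsReduced] in
/-- A Weyl group invariant function on the roots that satisfies `n j ∣ ⟨j, i⟩ * n i` depends only
on the length of the root. -/
lemma eq_of_norm_eq {n : ι → ℕ} (hr : ∀ i j, n (P.reflectionPerm i j) = n j)
    (hd : ∀ i j, (n j : ℤ) ∣ P.pairingIn ℤ j i * n i) {i j : ι}
    (hij : ‖P.root i‖ = ‖P.root j‖) : n i = n j := by
  obtain ⟨k, ⟨hk, hkl⟩, hki⟩ := P.exists_mem_pairing_ne_zero
    (T := {k | n k = n j ∧ ‖P.root k‖ = ‖P.root j‖}) ⟨j, rfl, rfl⟩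
    (fun a b hb ↦ ⟨(hr a b).trans hb.1, (norm_root_reflectionPerm hP a b).trans hb.2⟩) i
  rw [← hk]
  have hz : P.pairingIn ℤ k i ≠ 0 := fun h ↦ hki (by rw [← P.algebraMap_pairingIn ℤ, h, map_zero])
  by_cases h1 : k = i
  · rw [h1]
  by_cases h2 : P.root k = -P.root i
  · have : k = P.reflectionPerm i i := P.root.injective (by simpa using h2)
    rw [this, hr]
  -- Non-proportional, non-orthogonal roots of equal length pair to `1` or `-1` both ways, so the
  -- moduli divide each other.
  have hmem := P.pairingIn_pairingIn_mem_set_of_length_eq_of_ne (B := P.innerInvariantForm hP)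
    (i := k) (j := i) (by simp only [innerInvariantForm_root_root, hkl, hij]) h1 h2
  have d1 := hd i k
  have d2 := hd k i
  simp only [Set.mem_insert_iff, Set.mem_singleton_iff, Prod.mk.injEq] at hmem
  rcases hmem with ⟨h, h'⟩ | ⟨h, h'⟩ | ⟨h, h'⟩
  · exact absurd h hz
  all_goals
    rw [h] at d1
    rw [h'] at d2
    simp only [one_mul, neg_mul, dvd_neg, Int.natCast_dvd_natCast] at d1 d2
    exact Nat.dvd_antisymm d2 d1

/-- Weyl group invariant moduli with `n j ∣ ⟨j, i⟩ * n i` are given by one modulus for the long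
roots and one for the short roots. -/
lemma exists_moduli [Nonempty ι] {n : ι → ℕ} (hr : ∀ i j, n (P.reflectionPerm i j) = n j)
    (hd : ∀ i j, (n j : ℤ) ∣ P.pairingIn ℤ j i * n i) :
    ∃ l s : ℕ, s ∣ l ∧ l ∣ lacingNumber (Set.range P.root) * s ∧
      (∀ i, P.root i ∈ longRoots (Set.range P.root) → n i = l) ∧
      ∀ i, P.root i ∉ longRoots (Set.range P.root) → n i = s := by
  obtain ⟨i₀, hi₀⟩ := exists_mem_longRoots (P := P)
  have hlong (i : ι) (hi : P.root i ∈ longRoots (Set.range P.root)) : n i = n i₀ :=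
    eq_of_norm_eq hP hr hd (norm_eq_of_mem_longRoots hi hi₀)
  rcases lacingNumber_cases hP with ⟨-, h⟩ | ⟨hm, ⟨j₀, hj₀⟩, h⟩
  -- Without short roots `s` is arbitrary; `s = l` satisfies the divisibilities.
  · exact ⟨n i₀, n i₀, dvd_rfl, dvd_mul_left _ _, hlong, fun i hi ↦ absurd (h i) hi⟩
  obtain ⟨k, hk, hkj⟩ := P.exists_mem_pairing_ne_zero
    (T := {k | P.root k ∈ longRoots (Set.range P.root)}) ⟨i₀, hi₀⟩
    (fun a b hb ↦ (reflectionPerm_mem_longRoots_iff hP a b).2 hb) j₀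
  have hz : P.pairingIn ℤ k j₀ ≠ 0 :=
    fun h ↦ hkj (by rw [← P.algebraMap_pairingIn ℤ, h, map_zero])
  have hpair := pairingIn_long_short hP hk hj₀
  have hmem := P.pairingIn_pairingIn_mem_set_of_isCrystal_of_isRed k j₀
  -- Hence `⟨k, j₀⟩ = ±m`, and the two instances of `hd` become `s ∣ l` and `l ∣ m s`.
  have hj1 : P.pairingIn ℤ j₀ k = 1 ∨ P.pairingIn ℤ j₀ k = -1 := by
    have hm2 : (2 : ℤ) ≤ lacingNumber (Set.range P.root) := by exact_mod_cast hm.two_le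
    generalize (lacingNumber (Set.range P.root) : ℤ) = m at *
    simp only [Set.mem_insert_iff, Set.mem_singleton_iff, Prod.mk.injEq] at hmem
    rcases hmem with h | h | h | h | h | h | h | h | h | h | h | h | h <;>
      rw [h.1, h.2] at hpair <;> lia
  have d1 := hd j₀ k
  have d2 := hd k j₀
  rw [hlong k hk] at d1 d2
  rw [hpair] at d1
  refine ⟨n i₀, n j₀, ?_, ?_, hlong, fun j hj ↦ ?_⟩
  · rcases hj1 with h | h <;> rw [h] at d2 <;> simpa [Int.natCast_dvd_natCast] using d2
  · rw [← Int.natCast_dvd_natCast, Nat.cast_mul]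
    rcases hj1 with h | h <;> rw [h] at d1 <;> simpa using d1
  · refine eq_of_norm_eq hP hr hd ?_
    have h1 := h i₀ j hi₀ hj
    rw [h i₀ j₀ hi₀ hj₀] at h1
    have hm0 : (lacingNumber (Set.range P.root) : ℝ) ≠ 0 := by exact_mod_cast hm.ne_zero
    exact ((sq_eq_sq₀ (norm_nonneg _) (norm_nonneg _)).1 (mul_left_cancel₀ hm0 h1)).symm

end Length

end RootPairing

/-! ### Gradients and lifts -/

section Gradient

variable {V : Type*}

lemma rootGradient_untwistedLift (S : Set V) : rootGradient (untwistedLift S) = S := by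
  ext α
  exact ⟨fun ⟨y, hy⟩ ↦ hy.1, fun h ↦ ⟨0, h, 0, by simp⟩⟩

lemma subset_untwistedLift_rootGradient {R : Set V} {Ψ : Set (V × ℝ)} (h : Ψ ⊆ untwistedLift R) :
    Ψ ⊆ untwistedLift (rootGradient Ψ) :=
  fun x hx ↦ ⟨⟨x.2, hx⟩, (h hx).2⟩

lemma rootGradient_mono {Ψ Ψ' : Set (V × ℝ)} (h : Ψ ⊆ Ψ') : rootGradient Ψ ⊆ rootGradient Ψ' :=
  fun _ ⟨y, hy⟩ ↦ ⟨y, h hy⟩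

end Gradient

/-! ### Unions of cosets with length-dependent moduli -/

namespace RootPairing

variable {ι V N : Type*} [NormedAddCommGroup V] [InnerProductSpace ℝ V] [AddCommGroup N]
  [Module ℝ N] (P : RootPairing ι ℝ V N)

open Classical in
/-- The modulus attached to a root: `l` for long roots and `s` for short roots. -/
noncomputable def lengthModulus (l s : ℕ) (i : ι) : ℕ :=
  if P.root i ∈ longRoots (Set.range P.root) then l else s

/-- The set of all affine roots `α ⊕ n` with `n` congruent to `p α` modulo `l` if `α` is long and
modulo `s` if `α` is short. -/
def cosetRoots (p : P.rootSpan ℤ →ₗ[ℤ] ℤ) (l s : ℕ) : Set (V × ℝ) :=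
  {x | ∃ i, ∃ n : ℤ, x = (P.root i, (n : ℝ)) ∧
    (P.lengthModulus l s i : ℤ) ∣ n - p (P.rootSpanMem ℤ i)}

variable {P}

lemma lengthModulus_of_long (l s : ℕ) {i : ι} (hi : P.root i ∈ longRoots (Set.range P.root)) :
    P.lengthModulus l s i = l := if_pos hi

lemma lengthModulus_of_short (l s : ℕ) {i : ι} (hi : P.root i ∉ longRoots (Set.range P.root)) :
    P.lengthModulus l s i = s := if_neg hi

lemma lengthModulus_same (l : ℕ) (i : ι) : P.lengthModulus l l i = l := ite_self _

lemma mem_cosetRoots_iff {p : P.rootSpan ℤ →ₗ[ℤ] ℤ} {l s : ℕ} {i : ι} {n : ℤ} :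
    (P.root i, (n : ℝ)) ∈ P.cosetRoots p l s ↔
      (P.lengthModulus l s i : ℤ) ∣ n - p (P.rootSpanMem ℤ i) := by
  refine ⟨?_, fun h ↦ ⟨i, n, rfl, h⟩⟩
  rintro ⟨j, k, h, hd⟩
  rw [Prod.mk.injEq, P.root.injective.eq_iff, Int.cast_inj] at h
  rwa [h.1, h.2]

lemma cosetRoots_subset (p : P.rootSpan ℤ →ₗ[ℤ] ℤ) (l s : ℕ) :
    P.cosetRoots p l s ⊆ untwistedLift (Set.range P.root) := by
  rintro - ⟨i, n, rfl, -⟩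
  exact ⟨⟨i, rfl⟩, n, rfl⟩

lemma cosetRoots_one_one (p : P.rootSpan ℤ →ₗ[ℤ] ℤ) :
    P.cosetRoots p 1 1 = untwistedLift (Set.range P.root) := by
  refine (cosetRoots_subset p 1 1).antisymm ?_
  rintro ⟨-, -⟩ ⟨⟨i, rfl⟩, n, rfl⟩
  exact mem_cosetRoots_iff.2 (by simp [lengthModulus_same])

lemma apply_mem_cosetRoots (p : P.rootSpan ℤ →ₗ[ℤ] ℤ) (l s : ℕ) (i : ι) :
    (P.root i, (p (P.rootSpanMem ℤ i) : ℝ)) ∈ P.cosetRoots p l s :=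
  mem_cosetRoots_iff.2 (by simp)

lemma rootGradient_cosetRoots (p : P.rootSpan ℤ →ₗ[ℤ] ℤ) (l s : ℕ) :
    rootGradient (P.cosetRoots p l s) = Set.range P.root := by
  ext α
  constructor
  · rintro ⟨y, i, n, h, -⟩
    exact ⟨i, (congrArg Prod.fst h).symm⟩
  · rintro ⟨i, rfl⟩
    exact ⟨_, apply_mem_cosetRoots p l s i⟩

lemma cosetRoots_subset_cosetRoots (p : P.rootSpan ℤ →ₗ[ℤ] ℤ) {l s l' s' : ℕ} (hl : l' ∣ l)
    (hs : s' ∣ s) : P.cosetRoots p l s ⊆ P.cosetRoots p l' s' := by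
  rintro - ⟨i, n, rfl, h⟩
  refine mem_cosetRoots_iff.2 (dvd_trans ?_ h)
  rw [Int.natCast_dvd_natCast]
  unfold lengthModulus
  split_ifs <;> assumption

/-- If one set of cosets contains another, the moduli divide each other. -/
lemma lengthModulus_dvd_of_subset {p p' : P.rootSpan ℤ →ₗ[ℤ] ℤ} {l s l' s' : ℕ}
    (h : P.cosetRoots p l s ⊆ P.cosetRoots p' l' s') (i : ι) :
    P.lengthModulus l' s' i ∣ P.lengthModulus l s i := by
  have h1 := mem_cosetRoots_iff.1 (h (apply_mem_cosetRoots p l s i))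
  have h2 : (P.root i, ((p (P.rootSpanMem ℤ i) + P.lengthModulus l s i : ℤ) : ℝ)) ∈ _ :=
    h (mem_cosetRoots_iff.2 (by simp))
  have h3 := dvd_sub (mem_cosetRoots_iff.1 h2) h1
  rw [← Int.natCast_dvd_natCast]
  simpa using h3

/-- Nested cosets of the same modulus coincide. -/
lemma cosetRoots_eq_of_subset {p p' : P.rootSpan ℤ →ₗ[ℤ] ℤ} {l s : ℕ}
    (h : P.cosetRoots p l s ⊆ P.cosetRoots p' l s) :
    P.cosetRoots p l s = P.cosetRoots p' l s := by
  refine h.antisymm ?_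
  rintro - ⟨i, n, rfl, hn⟩
  have h1 := mem_cosetRoots_iff.1 (h (apply_mem_cosetRoots p l s i))
  refine mem_cosetRoots_iff.2 ?_
  simpa using dvd_sub hn h1

lemma fst_formReflection_affineForm (x y : V × ℝ) :
    (formReflection (affineForm V) x y).1 = formReflection (innerₗ V) x.1 y.1 := by
  simp [formReflection, affineForm]

/-- The gradient of a root subsystem is a root subsystem. -/
lemma isRootSubsystem_rootGradient {R : Set V} {Ψ : Set (V × ℝ)}
    (h : IsRootSubsystem (affineForm V) (untwistedLift R) Ψ) :
    IsRootSubsystem (innerₗ V) R (rootGradient Ψ) := by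
  obtain ⟨h1, ⟨x, hx⟩, h3⟩ := h
  refine ⟨fun α ⟨y, hy⟩ ↦ (h1 hy).1, ⟨x.1, x.2, hx⟩, ?_⟩
  rintro α ⟨a, ha⟩ β ⟨b, hb⟩
  refine ⟨(formReflection (affineForm V) (α, a) (β, b)).2, ?_⟩
  rw [← fst_formReflection_affineForm (α, a) (β, b)]
  exact h3 _ ha _ hb

/-- If the moduli are not all `1`, the cosets form a proper subset of the affine root system. -/
lemma cosetRoots_ne [Finite ι] [Nonempty ι] (p : P.rootSpan ℤ →ₗ[ℤ] ℤ) {l s : ℕ} (hl : l ≠ 1) :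
    P.cosetRoots p l s ≠ untwistedLift (Set.range P.root) := by
  obtain ⟨i, hi⟩ := exists_mem_longRoots (P := P)
  intro h
  rw [← cosetRoots_one_one p] at h
  have := lengthModulus_dvd_of_subset h.ge i
  rw [lengthModulus_same, lengthModulus_of_long l s hi, Nat.dvd_one] at this
  exact hl this

lemma isRootSubsystem_shortRoots
    (hP : ∀ (i : ι) (v : V), P.reflection i v = formReflection (innerₗ V) (P.root i) v)
    (h : ∃ i, P.root i ∉ longRoots (Set.range P.root)) :
    IsRootSubsystem (innerₗ V) (Set.range P.root) (shortRoots (Set.range P.root)) := by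
  obtain ⟨i, hi⟩ := h
  refine ⟨Set.sdiff_subset, ⟨P.root i, ⟨i, rfl⟩, hi⟩, ?_⟩
  rintro - ⟨⟨i, rfl⟩, hi⟩ - ⟨⟨j, rfl⟩, hj⟩
  rw [← hP, ← root_reflectionPerm, root_mem_shortRoots_iff, reflectionPerm_mem_longRoots_iff hP]
  exact hj

lemma shortRoots_ne [Finite ι] [Nonempty ι] : shortRoots (Set.range P.root) ≠ Set.range P.root := by
  obtain ⟨i, hi⟩ := exists_mem_longRoots (P := P)
  exact fun h ↦ (h.ge ⟨i, rfl⟩).2 hi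

/-! ### Reflections of affine roots -/

section Crystallographic

variable [P.IsCrystallographic]
  (hP : ∀ (i : ι) (v : V), P.reflection i v = formReflection (innerₗ V) (P.root i) v)

include hP

/-- The form ignores the second component, so the reflection coefficient is the Cartan integer of
the gradients. -/
lemma formReflection_affineForm_root (i j : ι) (a b : ℤ) :
    formReflection (affineForm V) (P.root i, (a : ℝ)) (P.root j, (b : ℝ)) =
      (P.root (P.reflectionPerm i j), ((b - P.pairingIn ℤ j i * a : ℤ) : ℝ)) := by
  have h := hP i (P.root j)
  have hc : 2 * innerₗ V (P.root j) (P.root i) / innerₗ V (P.root i) (P.root i) =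
      P.pairingIn ℤ j i := by
    rw [reflection_apply_root, ← P.algebraMap_pairingIn ℤ, formReflection, sub_right_inj] at h
    simpa using (smul_left_injective ℝ (P.ne_zero i) h).symm
  refine Prod.ext ?_ ?_
  · rw [fst_formReflection_affineForm, root_reflectionPerm, hP]
  · simp only [formReflection, affineForm, LinearMap.compl₁₂_apply, LinearMap.fst_apply, hc,
      Prod.snd_sub, Prod.smul_snd, smul_eq_mul]
    push_cast; rfl

/-- The root subsystems of the affine root system correspond to reflection stable families. -/
lemma isReflectionStable_of_isRootSubsystem {Ψ : Set (V × ℝ)}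
    (h : IsRootSubsystem (affineForm V) (untwistedLift (Set.range P.root)) Ψ) :
    P.IsReflectionStable fun i ↦ {n : ℤ | (P.root i, (n : ℝ)) ∈ Ψ} := fun i j a ha b hb ↦ by
  have := h.2.2 _ ha _ hb
  rwa [formReflection_affineForm_root hP] at this

lemma isRootSubsystem_untwistedLift {S : Set V}
    (h : IsRootSubsystem (innerₗ V) (Set.range P.root) S) :
    IsRootSubsystem (affineForm V) (untwistedLift (Set.range P.root)) (untwistedLift S) := by
  obtain ⟨h1, ⟨x, hx⟩, h3⟩ := h
  refine ⟨fun x hx ↦ ⟨h1 hx.1, hx.2⟩, ⟨(x, 0), hx, 0, by simp⟩, ?_⟩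
  rintro ⟨α, -⟩ ⟨hα, a, rfl⟩ ⟨β, -⟩ ⟨hβ, b, rfl⟩
  refine ⟨?_, ?_⟩
  · rw [fst_formReflection_affineForm]
    exact h3 _ hα _ hβ
  · obtain ⟨i, rfl⟩ := h1 hα
    obtain ⟨j, rfl⟩ := h1 hβ
    rw [formReflection_affineForm_root hP]
    exact ⟨_, rfl⟩

/-! ### Subsystems with full gradient and maximality -/

variable [Finite ι] [P.IsReduced] [P.IsIrreducible]

lemma isRootSubsystem_cosetRoots [Nonempty ι] (p : P.rootSpan ℤ →ₗ[ℤ] ℤ) {l s : ℕ} (h1 : s ∣ l)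
    (h2 : l ∣ lacingNumber (Set.range P.root) * s) :
    IsRootSubsystem (affineForm V) (untwistedLift (Set.range P.root)) (P.cosetRoots p l s) := by
  refine ⟨cosetRoots_subset p l s, ⟨_, apply_mem_cosetRoots p l s (Classical.arbitrary ι)⟩, ?_⟩
  rintro - ⟨i, a, rfl, ha⟩ - ⟨j, b, rfl, hb⟩
  rw [formReflection_affineForm_root hP, mem_cosetRoots_iff, map_rootSpanMem_reflectionPerm]
  have hmod : P.lengthModulus l s (P.reflectionPerm i j) = P.lengthModulus l s j := by
    by_cases hj : P.root j ∈ longRoots (Set.range P.root)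
    · rw [lengthModulus_of_long l s hj,
        lengthModulus_of_long l s ((reflectionPerm_mem_longRoots_iff hP i j).2 hj)]
    · rw [lengthModulus_of_short l s hj,
        lengthModulus_of_short l s (mt (reflectionPerm_mem_longRoots_iff hP i j).1 hj)]
  -- The critical case is `i` short and `j` long: there the pairing is divisible by the lacing
  -- number `m`, and `l ∣ m s` applies.
  have hdvd : (P.lengthModulus l s j : ℤ) ∣ P.pairingIn ℤ j i * P.lengthModulus l s i := by
    by_cases hi : P.root i ∈ longRoots (Set.range P.root) <;>
      by_cases hj : P.root j ∈ longRoots (Set.range P.root)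
    · rw [lengthModulus_of_long l s hi, lengthModulus_of_long l s hj]
      exact dvd_mul_left _ _
    · rw [lengthModulus_of_long l s hi, lengthModulus_of_short l s hj]
      exact dvd_mul_of_dvd_right (Int.natCast_dvd_natCast.2 h1) _
    · rw [lengthModulus_of_short l s hi, lengthModulus_of_long l s hj,
        pairingIn_long_short hP hj hi, mul_right_comm]
      exact dvd_mul_of_dvd_left (by exact_mod_cast h2) _
    · rw [lengthModulus_of_short l s hi, lengthModulus_of_short l s hj]
      exact dvd_mul_left _ _
  rw [hmod]
  have := dvd_sub hb (hdvd.trans (mul_dvd_mul_left (P.pairingIn ℤ j i) ha))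
  rwa [show b - P.pairingIn ℤ j i * a -
      (p (P.rootSpanMem ℤ j) - P.pairingIn ℤ j i * p (P.rootSpanMem ℤ i)) =
    b - p (P.rootSpanMem ℤ j) - P.pairingIn ℤ j i * (a - p (P.rootSpanMem ℤ i)) by ring]

/-- A root subsystem whose gradient is the whole finite root system consists of cosets whose moduli
depend only on the length of the root. -/
lemma exists_eq_cosetRoots [Nonempty ι] {Ψ : Set (V × ℝ)}
    (h : IsRootSubsystem (affineForm V) (untwistedLift (Set.range P.root)) Ψ)
    (hgr : Set.range P.root ⊆ rootGradient Ψ) :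
    ∃ (p : P.rootSpan ℤ →ₗ[ℤ] ℤ) (l s : ℕ), s ∣ l ∧ l ∣ lacingNumber (Set.range P.root) * s ∧
      Ψ = P.cosetRoots p l s := by
  obtain ⟨p, n, hZ, hr, hd⟩ :=
    (isReflectionStable_of_isRootSubsystem hP h).exists_coset P fun i ↦ by
      obtain ⟨y, hy⟩ := hgr ⟨i, rfl⟩
      obtain ⟨k, rfl⟩ := (h.1 hy).2
      exact ⟨k, hy⟩
  obtain ⟨l, s, h1, h2, hl, hs⟩ := exists_moduli hP hr hd
  have hn (i : ι) : n i = P.lengthModulus l s i := by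
    unfold lengthModulus
    split_ifs with hi
    exacts [hl i hi, hs i hi]
  refine ⟨p, l, s, h1, h2, Set.ext fun x ↦ ⟨fun hx ↦ ?_, ?_⟩⟩
  · obtain ⟨v, y⟩ := x
    obtain ⟨⟨i, rfl⟩, k, rfl⟩ := h.1 hx
    rw [mem_cosetRoots_iff, ← hn]
    exact (hZ i k).1 hx
  · rintro ⟨i, k, rfl, hk⟩
    rw [← hn] at hk
    exact (hZ i k).2 hk

/-- Maximality of a set of cosets can be tested on the moduli. -/
lemma isMaximalRootSubsystem_cosetRoots [Nonempty ι] (p : P.rootSpan ℤ →ₗ[ℤ] ℤ) {l s : ℕ}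
    (hl : l ≠ 1) (h1 : s ∣ l) (h2 : l ∣ lacingNumber (Set.range P.root) * s)
    (h : ∀ l' s' : ℕ, l' ≠ 1 → s' ∣ l' → l' ∣ lacingNumber (Set.range P.root) * s' → l' ∣ l →
      ((∃ i, P.root i ∉ longRoots (Set.range P.root)) → s' ∣ s) →
      l' = l ∧ ((∃ i, P.root i ∉ longRoots (Set.range P.root)) → s' = s)) :
    IsMaximalRootSubsystem (affineForm V) (untwistedLift (Set.range P.root))
      (P.cosetRoots p l s) := by
  refine ⟨isRootSubsystem_cosetRoots hP p h1 h2, cosetRoots_ne p hl, fun Ψ' hΨ' hle hne ↦ ?_⟩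
  obtain ⟨p', l', s', h1', h2', rfl⟩ := exists_eq_cosetRoots hP hΨ' <| by
    rw [← rootGradient_cosetRoots p l s]
    exact rootGradient_mono hle
  have hl' : l' ≠ 1 := by
    rintro rfl
    rw [Nat.dvd_one] at h1'
    exact hne (by rw [h1', cosetRoots_one_one])
  have hdvd := lengthModulus_dvd_of_subset hle
  obtain ⟨i, hi⟩ := exists_mem_longRoots (P := P)
  obtain ⟨h3, h4⟩ := h l' s' hl' h1' h2'
    (by simpa only [lengthModulus_of_long _ _ hi] using hdvd i)
    (fun ⟨j, hj⟩ ↦ by simpa only [lengthModulus_of_short _ _ hj] using hdvd j)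
  -- If there are no short roots, `s'` and `s` may differ, but they do not affect the sets.
  have : P.cosetRoots p' l' s' = P.cosetRoots p' l s := by
    have hmod (j : ι) : P.lengthModulus l' s' j = P.lengthModulus l s j := by
      by_cases hj : P.root j ∈ longRoots (Set.range P.root)
      · simp only [lengthModulus_of_long _ _ hj, h3]
      · simp only [lengthModulus_of_short _ _ hj, h4 ⟨j, hj⟩]
    simp only [cosetRoots, hmod]
  rw [this] at hle ⊢
  exact cosetRoots_eq_of_subset hle

lemma isMaximalRootSubsystem_cosetRoots_lacingNumber [Nonempty ι] (p : P.rootSpan ℤ →ₗ[ℤ] ℤ)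
    (hm : lacingNumber (Set.range P.root) ≠ 1) :
    IsMaximalRootSubsystem (affineForm V) (untwistedLift (Set.range P.root))
      (P.cosetRoots p (lacingNumber (Set.range P.root)) 1) := by
  obtain ⟨h, -⟩ | ⟨hprime, -⟩ := lacingNumber_cases hP
  · exact absurd h hm
  · refine isMaximalRootSubsystem_cosetRoots hP p hm (one_dvd _) (by simp) ?_
    intro l' s' hl' h1 h2 h3 h4
    exact ⟨((Nat.dvd_prime hprime).1 h3).resolve_left hl', fun h ↦ Nat.dvd_one.1 (h4 h)⟩

lemma isMaximalRootSubsystem_cosetRoots_prime [Nonempty ι] (p : P.rootSpan ℤ →ₗ[ℤ] ℤ)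
    {q : ℕ} (hq : q.Prime) (hm : q ≠ lacingNumber (Set.range P.root)) :
    IsMaximalRootSubsystem (affineForm V) (untwistedLift (Set.range P.root))
      (P.cosetRoots p q q) := by
  refine isMaximalRootSubsystem_cosetRoots hP p hq.ne_one dvd_rfl (dvd_mul_left _ _) ?_
  intro l' s' hl' h1 h2 h3 h4
  obtain rfl : l' = q := ((Nat.dvd_prime hq).1 h3).resolve_left hl'
  refine ⟨rfl, fun h ↦ ((Nat.dvd_prime hq).1 (h4 h)).resolve_left ?_⟩
  -- The pair `(q, 1)` would be the only competitor; it needs `q ∣ m`, which `q ≠ m` rules out.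
  rintro rfl
  rw [mul_one] at h2
  obtain ⟨h5, -⟩ | ⟨hprime, -⟩ := lacingNumber_cases hP
  · rw [h5, Nat.dvd_one] at h2; exact hl' h2
  · exact hm ((Nat.prime_dvd_prime_iff_eq hq hprime).1 h2)

/-- A maximal root subsystem with full gradient is one of two kinds. -/
lemma IsMaximalRootSubsystem.exists_eq_cosetRoots [Nonempty ι] {Ψ : Set (V × ℝ)}
    (h : IsMaximalRootSubsystem (affineForm V) (untwistedLift (Set.range P.root)) Ψ)
    (hgr : Set.range P.root ⊆ rootGradient Ψ) :
    ∃ p : P.rootSpan ℤ →ₗ[ℤ] ℤ,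
      (lacingNumber (Set.range P.root) ≠ 1 ∧
        Ψ = P.cosetRoots p (lacingNumber (Set.range P.root)) 1) ∨
      ∃ q : ℕ, q.Prime ∧ q ≠ lacingNumber (Set.range P.root) ∧ Ψ = P.cosetRoots p q q := by
  obtain ⟨p, l, s, h1, h2, rfl⟩ := RootPairing.exists_eq_cosetRoots hP h.1 hgr
  refine ⟨p, ?_⟩
  have hm : lacingNumber (Set.range P.root) = 1 ∨ (lacingNumber (Set.range P.root)).Prime :=
    (lacingNumber_cases hP).imp And.left And.left
  have hl : l ≠ 1 := by
    rintro rfl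
    rw [Nat.dvd_one] at h1
    exact h.2.1 (by rw [h1, cosetRoots_one_one])
  have hmax (l' s' : ℕ) (hl' : l' ≠ 1) (h1' : s' ∣ l')
      (h2' : l' ∣ lacingNumber (Set.range P.root) * s') (hll : l' ∣ l) (hss : s' ∣ s) :
      P.cosetRoots p l s = P.cosetRoots p l' s' :=
    h.2.2 _ (isRootSubsystem_cosetRoots hP p h1' h2') (cosetRoots_subset_cosetRoots p hll hss)
      (cosetRoots_ne p hl')
  by_cases hs : s = 1
  · subst hs
    rw [mul_one] at h2
    rcases hm with hm | hm
    · rw [hm, Nat.dvd_one] at h2; exact absurd h2 hl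
    · exact .inl ⟨hm.ne_one, by rw [((Nat.dvd_prime hm).1 h2).resolve_left hl]⟩
  -- This also covers `s = 0`, where every fibre over a short root is a single point. The pair `(q,
  -- q)` is coarser than `(l, s)`, and for `q = m` so is `(m, 1)`.
  · obtain ⟨q, hq, hqs⟩ := Nat.exists_prime_and_dvd hs
    by_cases hqm : q = lacingNumber (Set.range P.root)
    · rw [← hqm] at hmax ⊢
      exact .inl ⟨hq.ne_one, hmax q 1 hq.ne_one (one_dvd _) (by simp) (hqs.trans h1) (one_dvd _)⟩
    · exact .inr ⟨q, hq, hqm,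
        hmax q q hq.ne_one dvd_rfl (dvd_mul_left _ _) (hqs.trans h1) hqs⟩

/-- The lift of a maximal root subsystem other than the short roots is maximal. -/
lemma isMaximalRootSubsystem_untwistedLift [Nonempty ι] {S : Set V}
    (h : IsMaximalRootSubsystem (innerₗ V) (Set.range P.root) S)
    (hS : S ≠ shortRoots (Set.range P.root)) :
    IsMaximalRootSubsystem (affineForm V) (untwistedLift (Set.range P.root))
      (untwistedLift S) := by
  refine ⟨isRootSubsystem_untwistedLift hP h.1, fun heq ↦ h.2.1 ?_, fun Ψ' hΨ' hle hne ↦ ?_⟩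
  · rw [← rootGradient_untwistedLift S, heq, rootGradient_untwistedLift]
  have hgr := rootGradient_mono hle
  rw [rootGradient_untwistedLift] at hgr
  by_cases hfull : rootGradient Ψ' = Set.range P.root
  · obtain ⟨p, l, s, h1, h2, rfl⟩ := exists_eq_cosetRoots hP hΨ' hfull.ge
    -- Otherwise `S` lies in the short roots, and equals them by maximality. The full fibre over a
    -- long root then forces `l = 1`, hence `s = 1`.
    obtain ⟨i, hiS, hi⟩ : ∃ i, P.root i ∈ S ∧ P.root i ∈ longRoots (Set.range P.root) := by
      by_contra! hno
      have hsub : S ⊆ shortRoots (Set.range P.root) := fun x hx ↦ by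
        obtain ⟨i, rfl⟩ := h.1.1 hx
        exact ⟨⟨i, rfl⟩, hno i hx⟩
      obtain ⟨x, hx⟩ := h.1.2.1
      obtain ⟨i, rfl⟩ := h.1.1 hx
      exact hS (h.2.2 _ (isRootSubsystem_shortRoots hP ⟨i, hno i hx⟩) hsub shortRoots_ne)
    have hmem (n : ℤ) : (P.root i, (n : ℝ)) ∈ P.cosetRoots p l s := hle ⟨hiS, n, rfl⟩
    have hd := dvd_sub (mem_cosetRoots_iff.1 (hmem 1)) (mem_cosetRoots_iff.1 (hmem 0))
    rw [lengthModulus_of_long l s hi] at hd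
    have hl : l = 1 := by
      rw [← Nat.dvd_one, ← Int.natCast_dvd_natCast]
      simpa using hd
    subst hl
    rw [Nat.dvd_one] at h1
    exact absurd (by rw [h1, cosetRoots_one_one]) hne
  · refine hle.antisymm ?_
    rw [h.2.2 _ (isRootSubsystem_rootGradient hΨ') hgr hfull]
    exact subset_untwistedLift_rootGradient hΨ'.1

/-- A maximal root subsystem whose gradient is proper is the lift of its gradient. -/
lemma IsMaximalRootSubsystem.eq_untwistedLift [Nonempty ι] {Ψ : Set (V × ℝ)}
    (h : IsMaximalRootSubsystem (affineForm V) (untwistedLift (Set.range P.root)) Ψ)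
    (hgr : rootGradient Ψ ≠ Set.range P.root) :
    IsMaximalRootSubsystem (innerₗ V) (Set.range P.root) (rootGradient Ψ) ∧
      rootGradient Ψ ≠ shortRoots (Set.range P.root) ∧ Ψ = untwistedLift (rootGradient Ψ) := by
  have hG := isRootSubsystem_rootGradient h.1
  have hsub := subset_untwistedLift_rootGradient h.1.1
  have hlift {S : Set V} (hS : IsRootSubsystem (innerₗ V) (Set.range P.root) S)
      (hle : rootGradient Ψ ⊆ S) (hne : S ≠ Set.range P.root) : Ψ = untwistedLift S := by
    refine h.2.2 _ (isRootSubsystem_untwistedLift hP hS)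
      (fun x hx ↦ ⟨hle (hsub hx).1, (hsub hx).2⟩) fun heq ↦ hne ?_
    rw [← rootGradient_untwistedLift S, heq, rootGradient_untwistedLift]
  have heq := hlift hG subset_rfl hgr
  refine ⟨⟨hG, hgr, fun S hS hle hne ↦ ?_⟩, fun hshort ↦ ?_, heq⟩
  · rw [hlift hS hle hne, rootGradient_untwistedLift]
  · obtain ⟨x, hx⟩ := hG.2.1
    rw [hshort] at hx
    obtain ⟨-, hall⟩ | ⟨hm, -⟩ := lacingNumber_cases hP
    · obtain ⟨⟨i, rfl⟩, hi⟩ := hx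
      exact hi (hall i)
    -- The lifted short roots lie in a proper subsystem with full gradient, contradicting
    -- maximality.
    have hle : Ψ ⊆ P.cosetRoots 0 (lacingNumber (Set.range P.root)) 1 := by
      rw [heq, hshort]
      rintro ⟨-, -⟩ ⟨⟨⟨i, rfl⟩, hi⟩, n, rfl⟩
      rw [mem_cosetRoots_iff, lengthModulus_of_short _ _ hi]
      simp
    have h1 := h.2.2 _ (isRootSubsystem_cosetRoots hP 0 (one_dvd _) (by simp)) hle
      (cosetRoots_ne 0 hm.ne_one)
    exact hgr (by rw [h1, rootGradient_cosetRoots])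

end Crystallographic

/-! ### Explicit forms of the two families and the classification -/

lemma cosetRoots_one_right (p : P.rootSpan ℤ →ₗ[ℤ] ℤ) (l : ℕ) :
    P.cosetRoots p l 1 =
      {x | ∃ i : ι, P.root i ∈ shortRoots (Set.range P.root) ∧
          ∃ n : ℤ, x = (P.root i, (n : ℝ))} ∪
        {x | ∃ i : ι, P.root i ∈ longRoots (Set.range P.root) ∧
          ∃ n : ℤ, x = (P.root i, ((p (P.rootSpanMem ℤ i) + l * n : ℤ) : ℝ))} := by
  ext x
  constructor
  · rintro ⟨i, n, rfl, h⟩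
    by_cases hi : P.root i ∈ longRoots (Set.range P.root)
    · rw [lengthModulus_of_long _ _ hi] at h
      obtain ⟨k, hk⟩ := h
      exact .inr ⟨i, hi, k, by rw [← hk]; simp⟩
    · exact .inl ⟨i, (root_mem_shortRoots_iff i).2 hi, n, rfl⟩
  · rintro (⟨i, hi, n, rfl⟩ | ⟨i, hi, n, rfl⟩)
    · rw [root_mem_shortRoots_iff] at hi
      simp [mem_cosetRoots_iff, lengthModulus_of_short _ _ hi]
    · rw [mem_cosetRoots_iff, lengthModulus_of_long _ _ hi]
      simp

lemma cosetRoots_same (p : P.rootSpan ℤ →ₗ[ℤ] ℤ) (q : ℕ) :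
    P.cosetRoots p q q =
      {x | ∃ i : ι, ∃ n : ℤ,
        x = (P.root i, ((p (P.rootSpanMem ℤ i) + q * n : ℤ) : ℝ))} := by
  ext x
  constructor
  · rintro ⟨i, n, rfl, h⟩
    rw [lengthModulus_same] at h
    obtain ⟨k, hk⟩ := h
    exact ⟨i, k, by rw [← hk]; simp⟩
  · rintro ⟨i, n, rfl⟩
    rw [mem_cosetRoots_iff, lengthModulus_same]
    simp

end RootPairing

theorem proposition7p1 {ι V N : Type*} [Finite ι]
    [NormedAddCommGroup V] [InnerProductSpace ℝ V] [AddCommGroup N] [Module ℝ N]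
    (P : RootPairing ι ℝ V N) [P.IsRootSystem]
    [P.IsCrystallographic] [P.IsReduced] [P.IsIrreducible]
    (hP : ∀ (i : ι) (v : V), P.reflection i v = formReflection (innerₗ V) (P.root i) v)
    (Ψ : Set (V × ℝ)) (hΨ : Ψ ⊆ untwistedLift (Set.range P.root)) :
    IsMaximalRootSubsystem (affineForm V) (untwistedLift (Set.range P.root)) Ψ ↔
      (IsMaximalRootSubsystem (innerₗ V) (Set.range P.root) (rootGradient Ψ) ∧
        rootGradient Ψ ≠ shortRoots (Set.range P.root) ∧
        Ψ = untwistedLift (rootGradient Ψ)) ∨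
      ∃ p : P.rootSpan ℤ →ₗ[ℤ] ℤ,
        (∀ i : ι, (P.root i, (p (P.rootSpanMem ℤ i) : ℝ)) ∈ Ψ) ∧
        ((lacingNumber (Set.range P.root) ≠ 1 ∧
            Ψ = {x | ∃ i : ι, P.root i ∈ shortRoots (Set.range P.root) ∧
                  ∃ n : ℤ, x = (P.root i, (n : ℝ))} ∪
                {x | ∃ i : ι, P.root i ∈ longRoots (Set.range P.root) ∧
                  ∃ n : ℤ, x = (P.root i,
                    ((p (P.rootSpanMem ℤ i) + lacingNumber (Set.range P.root) * n : ℤ) : ℝ))}) ∨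
          ∃ q : ℕ, q.Prime ∧ q ≠ lacingNumber (Set.range P.root) ∧
            Ψ = {x | ∃ i : ι, ∃ n : ℤ,
                  x = (P.root i, ((p (P.rootSpanMem ℤ i) + q * n : ℤ) : ℝ))}) := by
  have : Nontrivial V := RootPairing.IsIrreducible.nontrivial P
  have : Nonempty ι := by
    by_contra hempty
    rw [not_nonempty_iff] at hempty
    have h := RootPairing.IsRootSystem.span_root_eq_top (P := P)
    simp only [Set.range_eq_empty, Submodule.span_empty] at h
    exact bot_ne_top h
  simp only [← RootPairing.cosetRoots_one_right, ← RootPairing.cosetRoots_same]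
  constructor
  · intro h
    by_cases hgr : rootGradient Ψ = Set.range P.root
    · obtain ⟨p, hp⟩ := RootPairing.IsMaximalRootSubsystem.exists_eq_cosetRoots hP h hgr.ge
      refine .inr ⟨p, fun i ↦ ?_, hp⟩
      obtain ⟨-, rfl⟩ | ⟨q, -, -, rfl⟩ := hp <;> exact RootPairing.apply_mem_cosetRoots _ _ _ i
    · exact .inl (RootPairing.IsMaximalRootSubsystem.eq_untwistedLift hP h hgr)
  · rintro (⟨h1, h2, h3⟩ | ⟨p, -, ⟨hm, rfl⟩ | ⟨q, hq, hqm, rfl⟩⟩)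
    · rw [h3]
      exact RootPairing.isMaximalRootSubsystem_untwistedLift hP h1 h2
    · exact RootPairing.isMaximalRootSubsystem_cosetRoots_lacingNumber hP p hm
    · exact RootPairing.isMaximalRootSubsystem_cosetRoots_prime hP p hq hqm
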